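/- Let a byte-level BPE tokenizer be given by a finite vocabulary $V$, in which every token $t$ stands for a byte string $\operatorname{bytes}(t)$ and every byte has a base token standing for it, together with a finite ordered merge list of rules $(t_l,t_r,t_{lr})$ with $\operatorname{bytes}(t_{lr})=\operatorname{bytes}(t_l)\,\|\,\operatorname{bytes}(t_r)$. Here $\operatorname{encode}(x)$ starts from the base tokens of the bytes of $x$ and, for each rule $(t_l,t_r,t_{lr})$ in order, replaces the leftmost adjacent pair $t_l,t_r$ by $t_{lr}$ for as long as there is such a pair (there is no pretokenization), and $\operatorname{decode}([t_1,\dots,t_n])=\operatorname{bytes}(t_1)\,\|\cdots\|\,\operatorname{bytes}(t_n)$. A token sequence $T$ is valid if $\operatorname{encode}(\operatorname{decode}(T))=T$. For a byte string $P$, the Valid Covering Tree $\operatorname{VCT}(P)$ is the tree of all finite token sequences $T=[t_1,\dots,t_n]$ such that (1) $P$ is a prefix of $\operatorname{decode}(T)$, (2) $\operatorname{decode}([t_1,\dots,t_{n-1}])$ is a prefix of $P$ (for the empty sequence $T$, $\operatorname{decode}$ of the empty sequence is meant), and (3) $T$ is valid. Its nodes are the initial segments of these sequences, its root is the empty sequence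 (the beginning-of-sequence token being left implicit), and its edges join a node $u$ to each node of the form $u\,\|\,[t]$ with $t\in V$. **Proposition.** For every such tokenizer there is an integer $L_0\ge 0$, depending only on the tokenizer, such that for every byte string $P$ there are an integer $0\le L\le L_0$ and a decomposition $P=P_{\mathrm{trunk}}\,\|\,P_{\mathrm{suffix}}$ with $|P_{\mathrm{suffix}}|=L$ for which: 1. every sequence $T$ of $\operatorname{VCT}(P)$ has $\operatorname{encode}(P_{\mathrm{trunk}})$ as a prefix; and 2. the number of edges of $\operatorname{VCT}(P)$ that do not lie on the path from the root to $\operatorname{encode}(P_{\mathrm{trunk}})$ is at most $(L+1)\,|V|$, and hence at most the tokenizer-dependent constant $(L_0+1)\,|V|$. -/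

import Mathlib

/-- One entry `(t_l, t_r, t_lr)` of a merge list: the adjacent tokens `left`, `right` are replaced
by the token `result`. -/
structure MergeRule (V : Type*) where
  left : V
  right : V
  result : V

/-- A byte-level BPE tokenizer with vocabulary `V`: every token stands for a byte string, every
byte has its own base token, and there is an ordered merge list, each of whose rules replaces two
tokens by a token that stands for the concatenation of their byte strings. -/
structure BPETokenizer (V : Type*) where
  /-- the byte string that a token stands for -/
  bytes : V → List UInt8
  /-- the base token of a byte -/
  byteToken : UInt8 → V
  /-- the ordered merge list -/
  merges : List (MergeRule V)
  bytes_byteToken : ∀ b, bytes (byteToken b) = [b]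
  bytes_result : ∀ m ∈ merges, bytes m.result = bytes m.left ++ bytes m.right

namespace BPETokenizer

variable {V : Type*}

/-- Merge the first (leftmost) match of the rule `m`; the sequence is unchanged if there is none. -/
def mergeFirst [DecidableEq V] (m : MergeRule V) : List V → List V
  | a :: b :: ts =>
      if a = m.left ∧ b = m.right then m.result :: ts else a :: mergeFirst m (b :: ts)
  | ts => ts

/-- "While there is a match of the rule `m`, merge the first match." Each merge shortens the
sequence by one token, so `ts.length` rounds always run the loop to its end, and the
remaining rounds change nothing. -/
def applyRule [DecidableEq V] (m : MergeRule V) (ts : List V) : List V :=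
  (mergeFirst m)^[ts.length] ts

/-- The BPE encoder: start from the base tokens of the bytes and apply the rules of the merge list
one after the other, in order. -/
def encode [DecidableEq V] (tok : BPETokenizer V) (x : List UInt8) : List V :=
  tok.merges.foldl (fun ts m => applyRule m ts) (x.map tok.byteToken)

/-- The BPE decoder: concatenate the byte strings of the tokens. -/
def decode (tok : BPETokenizer V) (T : List V) : List UInt8 :=
  T.flatMap tok.bytes

/-- A token sequence is valid if it is the encoding of the string that it decodes to. -/
def IsValid [DecidableEq V] (tok : BPETokenizer V) (T : List V) : Prop :=
  tok.encode (tok.decode T) = T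

/-- The token sequences that make up the Valid Covering Tree of `P`. The token `BOS`, which begins
every sequence and decodes to the empty string, is left implicit: it is the root of the tree,
that is, the empty list here. -/
def VCT [DecidableEq V] (tok : BPETokenizer V) (P : List UInt8) : Set (List V) :=
  {T | P <+: tok.decode T ∧ tok.decode T.dropLast <+: P ∧ tok.IsValid T}

/-- The nodes of the Valid Covering Tree: all initial segments of its sequences
(the root is the empty one). -/
def vctNodes [DecidableEq V] (tok : BPETokenizer V) (P : List UInt8) : Set (List V) :=
  {u | ∃ T ∈ tok.VCT P, u <+: T}

/-- The edges (parent, child) of the Valid Covering Tree: a child extends its parent by one token. -/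
def vctEdges [DecidableEq V] (tok : BPETokenizer V) (P : List UInt8) : Set (List V × List V) :=
  {e | e.1 ∈ tok.vctNodes P ∧ e.2 ∈ tok.vctNodes P ∧ ∃ t, e.2 = e.1 ++ [t]}

/-- The edges (parent, child) on the path from the root to the node `w`. -/
def pathEdges (w : List V) : Set (List V × List V) :=
  {e | e.2 <+: w ∧ ∃ t, e.2 = e.1 ++ [t]}

end BPETokenizer

/-! On the sequences that arise, exhausting a merge rule equals one left-to-right pass
(`applyRule_eq_scan`), and a pass looks only one token ahead. With k rules and tokens of at most M
bytes, all but k * M bytes of `P` therefore yield tokens `q` that begin every `encode (P ++ y)`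
(`exists_prefix_encode`). Passes can be cut, so prefixes of valid sequences are valid
(`IsValid.of_prefix`); hence `q` encodes its own decoding, which is the trunk. An edge off the trunk
path starts at a valid sequence extending `q` and decoding to a prefix of `P`. Validity makes it the
encoding of that prefix, leaving L + 1 parents with at most |V| children each. -/

namespace BPETokenizer

/-! ### Merge rules as single passes -/

section Scan

variable {V : Type*} [DecidableEq V]

/-- A single left-to-right pass that merges every match of the rule `m` it meets. -/
def scan (m : MergeRule V) : List V → List V
  | a :: b :: ts =>
      if a = m.left ∧ b = m.right then m.result :: scan m ts else a :: scan m (b :: ts)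
  | ts => ts

theorem scan_cons_of_not (m : MergeRule V) (a : V) (s : List V)
    (h : ¬ (a = m.left ∧ s.head? = some m.right)) : scan m (a :: s) = a :: scan m s := by
  cases s with
  | nil => simp [scan]
  | cons b s =>
    have h' : ¬ (a = m.left ∧ b = m.right) := by simpa using h
    rw [scan, if_neg h']

theorem scan_cons_of_match (m : MergeRule V) (s : List V) :
    scan m (m.left :: m.right :: s) = m.result :: scan m s := by
  rw [scan, if_pos ⟨rfl, rfl⟩]

theorem mergeFirst_cons_of_not (m : MergeRule V) (a : V) (s : List V)
    (h : ¬ (a = m.left ∧ s.head? = some m.right)) :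
    mergeFirst m (a :: s) = a :: mergeFirst m s := by
  cases s with
  | nil => simp [mergeFirst]
  | cons b s =>
    have h' : ¬ (a = m.left ∧ b = m.right) := by simpa using h
    rw [mergeFirst, if_neg h']

theorem mergeFirst_cons_of_match (m : MergeRule V) (s : List V) :
    mergeFirst m (m.left :: m.right :: s) = m.result :: s := by
  rw [mergeFirst, if_pos ⟨rfl, rfl⟩]

/-- Structural induction along a scan. -/
theorem scan_induction (m : MergeRule V) {motive : List V → Prop} (nil : motive [])
    (matched : ∀ s, motive s → motive (m.left :: m.right :: s))
    (unmatched : ∀ a s, ¬ (a = m.left ∧ s.head? = some m.right) → motive s → motive (a :: s)) :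
    ∀ ts, motive ts := by
  intro ts
  induction h : ts.length using Nat.strong_induction_on generalizing ts with
  | _ n ih =>
    subst h
    match ts with
    | [] => exact nil
    | a :: s =>
      by_cases hm : a = m.left ∧ s.head? = some m.right
      · obtain ⟨rfl, hs⟩ := hm
        obtain ⟨s', rfl⟩ := List.head?_eq_some_iff.1 hs
        exact matched s' (ih _ (by simp only [List.length_cons]; omega) s' rfl)
      · exact unmatched a s hm (ih _ (by simp) s rfl)

theorem head?_mergeFirst (m : MergeRule V) (hr : m.result ≠ m.right) (ts : List V)
    (h : (mergeFirst m ts).head? = some m.right) : ts.head? = some m.right := by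
  induction ts using scan_induction m with
  | nil => simp [mergeFirst] at h
  | matched s _ =>
    rw [mergeFirst_cons_of_match] at h
    simp [hr] at h
  | unmatched a s hs _ =>
    rw [mergeFirst_cons_of_not m a s hs] at h
    simpa using h

/-- A merged token is neither side of the rule, so it forms no new match with a neighbour. -/
theorem scan_mergeFirst (m : MergeRule V) (hl : m.result ≠ m.left) (hr : m.result ≠ m.right)
    (ts : List V) : scan m (mergeFirst m ts) = scan m ts := by
  induction ts using scan_induction m with
  | nil => simp [mergeFirst]
  | matched s _ =>
    rw [mergeFirst_cons_of_match, scan_cons_of_match, scan_cons_of_not]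
    exact fun h => hl h.1
  | unmatched a s hs ih =>
    rw [mergeFirst_cons_of_not m a s hs, scan_cons_of_not m a s hs, scan_cons_of_not, ih]
    exact fun h => hs ⟨h.1, head?_mergeFirst m hr s h.2⟩

theorem mergeFirst_length_lt_or (m : MergeRule V) (ts : List V) :
    (mergeFirst m ts).length < ts.length ∨ mergeFirst m ts = ts ∧ scan m ts = ts := by
  induction ts using scan_induction m with
  | nil => simp [mergeFirst, scan]
  | matched s _ => rw [mergeFirst_cons_of_match]; simp
  | unmatched a s hs ih =>
    rw [mergeFirst_cons_of_not m a s hs, scan_cons_of_not m a s hs]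
    simpa using ih

theorem iterate_mergeFirst_eq_scan (m : MergeRule V) (hl : m.result ≠ m.left)
    (hr : m.result ≠ m.right) (n : ℕ) (ts : List V) (h : ts.length ≤ n) :
    (mergeFirst m)^[n] ts = scan m ts := by
  induction n generalizing ts with
  | zero =>
    obtain rfl : ts = [] := by simpa using h
    simp [scan]
  | succ n ih =>
    rcases mergeFirst_length_lt_or m ts with hlt | ⟨h₁, h₂⟩
    · rw [Function.iterate_succ_apply, ih _ (by omega), scan_mergeFirst m hl hr]
    · rw [Function.iterate_fixed h₁, h₂]

theorem unmatchable (m : MergeRule V) (ts : List V) (h : m.left ∉ ts ∨ m.right ∉ ts) :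
    mergeFirst m ts = ts ∧ scan m ts = ts := by
  induction ts using scan_induction m with
  | nil => simp [mergeFirst, scan]
  | matched s _ => simp at h
  | unmatched a s hs ih =>
    rw [mergeFirst_cons_of_not m a s hs, scan_cons_of_not m a s hs]
    simpa using ih (by simp only [List.mem_cons, not_or] at h; tauto)

/-- A cut of the output of a scan comes from a cut of its input. -/
theorem exists_append_of_scan_eq_append (m : MergeRule V) (ts q r : List V)
    (h : scan m ts = q ++ r) : ∃ u v, ts = u ++ v ∧ scan m u = q ∧ scan m v = r := by
  induction ts using scan_induction m generalizing q with
  | nil =>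
    have h' : [] = q ++ r := by simpa [scan] using h
    obtain ⟨rfl, rfl⟩ := List.append_eq_nil_iff.1 h'.symm
    exact ⟨[], [], rfl, by simp [scan], by simp [scan]⟩
  | matched s ih =>
    cases q with
    | nil => exact ⟨[], _, rfl, by simp [scan], h⟩
    | cons x q =>
      rw [scan_cons_of_match, List.cons_append, List.cons.injEq] at h
      obtain ⟨u, v, rfl, hu, hv⟩ := ih q h.2
      exact ⟨m.left :: m.right :: u, v, rfl, by rw [scan_cons_of_match, hu, h.1], hv⟩
  | unmatched a s hs ih =>
    cases q with
    | nil => exact ⟨[], _, rfl, by simp [scan], h⟩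
    | cons x q =>
      rw [scan_cons_of_not m a s hs, List.cons_append, List.cons.injEq] at h
      obtain ⟨u, v, rfl, hu, hv⟩ := ih q h.2
      refine ⟨a :: u, v, rfl, ?_, hv⟩
      rw [scan_cons_of_not, hu, h.1]
      -- A match at the front of `a :: u` would survive appending `v`.
      exact fun hm => hs ⟨hm.1, by rw [List.head?_append, hm.2]; rfl⟩

end Scan

/-! ### Encoding, validity, lookahead and edge counting -/

section Encode

variable {V : Type*} (tok : BPETokenizer V)

@[simp] theorem decode_nil : tok.decode [] = [] := rfl

@[simp] theorem decode_cons (t : V) (ts : List V) :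
    tok.decode (t :: ts) = tok.bytes t ++ tok.decode ts := by simp [decode]

@[simp] theorem decode_append (u v : List V) :
    tok.decode (u ++ v) = tok.decode u ++ tok.decode v := by simp [decode]

theorem decode_prefix_decode {u v : List V} (h : u <+: v) : tok.decode u <+: tok.decode v := by
  obtain ⟨r, rfl⟩ := h
  simp

theorem decode_map_byteToken (x : List UInt8) : tok.decode (x.map tok.byteToken) = x := by
  induction x with
  | nil => rfl
  | cons b x ih => simp [tok.bytes_byteToken, ih]

/-- No token of the sequence stands for the empty string. -/
def NoEmpty (ts : List V) : Prop := ∀ t ∈ ts, tok.bytes t ≠ []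

theorem noEmpty_map_byteToken (x : List UInt8) : tok.NoEmpty (x.map tok.byteToken) := by
  intro t ht
  obtain ⟨b, -, rfl⟩ := List.mem_map.1 ht
  simp [tok.bytes_byteToken]

variable [DecidableEq V]

theorem decode_scan {m : MergeRule V} (hm : m ∈ tok.merges) (ts : List V) :
    tok.decode (scan m ts) = tok.decode ts := by
  induction ts using scan_induction m with
  | nil => simp [scan]
  | matched s ih => simp [scan_cons_of_match, ih, tok.bytes_result m hm]
  | unmatched a s hs ih => simp [scan_cons_of_not m a s hs, ih]

theorem NoEmpty.scan {tok : BPETokenizer V} {m : MergeRule V} (hm : m ∈ tok.merges) {ts : List V}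
    (h : tok.NoEmpty ts) : tok.NoEmpty (scan m ts) := by
  induction ts using scan_induction m with
  | nil => simpa [BPETokenizer.scan] using h
  | matched s ih =>
    simp only [NoEmpty, List.forall_mem_cons, scan_cons_of_match] at h ih ⊢
    exact ⟨by simp [tok.bytes_result m hm, h.1], ih h.2.2⟩
  | unmatched a s hs ih =>
    simp only [NoEmpty, List.forall_mem_cons, scan_cons_of_not m a s hs] at h ih ⊢
    exact ⟨h.1, ih h.2⟩

theorem applyRule_eq_scan {m : MergeRule V} (hm : m ∈ tok.merges) {ts : List V}
    (h : tok.NoEmpty ts) : applyRule m ts = scan m ts := by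
  have hb := tok.bytes_result m hm
  by_cases hl : tok.bytes m.left = []
  · have := unmatchable m ts (Or.inl fun hmem => h _ hmem hl)
    rw [applyRule, Function.iterate_fixed this.1, this.2]
  by_cases hr : tok.bytes m.right = []
  · have := unmatchable m ts (Or.inr fun hmem => h _ hmem hr)
    rw [applyRule, Function.iterate_fixed this.1, this.2]
  -- If the result equalled one side, the other side would decode to the empty string.
  refine iterate_mergeFirst_eq_scan m (fun e => ?_) (fun e => ?_) _ ts le_rfl
  · rw [e] at hb; simp [hr] at hb
  · rw [e] at hb; simp [hl] at hb

theorem foldl_applyRule_eq_foldl_scan (ms : List (MergeRule V)) (hms : ∀ m ∈ ms, m ∈ tok.merges)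
    (ts : List V) (h : tok.NoEmpty ts) :
    ms.foldl (fun ts m => applyRule m ts) ts = ms.foldl (fun ts m => scan m ts) ts := by
  induction ms generalizing ts with
  | nil => rfl
  | cons m ms ih =>
    rw [List.forall_mem_cons] at hms
    rw [List.foldl_cons, List.foldl_cons, tok.applyRule_eq_scan hms.1 h,
      ih hms.2 _ (h.scan hms.1)]

theorem encode_eq_foldl_scan (x : List UInt8) :
    tok.encode x = tok.merges.foldl (fun ts m => scan m ts) (x.map tok.byteToken) :=
  tok.foldl_applyRule_eq_foldl_scan _ (fun _ h => h) _ (tok.noEmpty_map_byteToken x)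

theorem decode_foldl_scan (ms : List (MergeRule V)) (hms : ∀ m ∈ ms, m ∈ tok.merges)
    (ts : List V) : tok.decode (ms.foldl (fun ts m => scan m ts) ts) = tok.decode ts := by
  induction ms generalizing ts with
  | nil => rfl
  | cons m ms ih =>
    rw [List.forall_mem_cons] at hms
    rw [List.foldl_cons, ih hms.2, tok.decode_scan hms.1]

theorem decode_encode (x : List UInt8) : tok.decode (tok.encode x) = x := by
  rw [encode_eq_foldl_scan, tok.decode_foldl_scan _ (fun _ h => h), decode_map_byteToken]

theorem exists_append_of_foldl_scan_eq_append (ms : List (MergeRule V)) (ts q r : List V)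
    (h : ms.foldl (fun ts m => scan m ts) ts = q ++ r) :
    ∃ u v, ts = u ++ v ∧ ms.foldl (fun ts m => scan m ts) u = q := by
  induction ms generalizing ts with
  | nil => exact ⟨q, r, h, rfl⟩
  | cons m ms ih =>
    obtain ⟨u, v, huv, hu⟩ := ih _ h
    obtain ⟨u', v', rfl, hu', -⟩ := exists_append_of_scan_eq_append m ts u v huv
    exact ⟨u', v', rfl, by rw [List.foldl_cons, hu', hu]⟩

/-- Initial segments of valid token sequences are valid. -/
theorem IsValid.of_prefix {tok : BPETokenizer V} {u T : List V} (hT : tok.IsValid T)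
    (h : u <+: T) : tok.IsValid u := by
  obtain ⟨r, rfl⟩ := h
  rw [IsValid, encode_eq_foldl_scan] at hT
  obtain ⟨y, z, hyz, hy⟩ := exists_append_of_foldl_scan_eq_append _ _ u r hT
  obtain ⟨x, x', -, rfl, -⟩ := List.map_eq_append_iff.1 hyz
  rw [← encode_eq_foldl_scan] at hy
  rw [IsValid, ← hy, decode_encode]

theorem isValid_encode (x : List UInt8) : tok.IsValid (tok.encode x) := by
  rw [IsValid, decode_encode]

/-- A scan has lookahead one: all but the last token of its input is processed independently of
what follows. -/
theorem exists_prefix_scan {M : ℕ} (hM : ∀ t, (tok.bytes t).length ≤ M) {m : MergeRule V}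
    (hm : m ∈ tok.merges) (p : List V) :
    ∃ q, (tok.decode p).length ≤ (tok.decode q).length + M ∧
      ∀ v, q <+: scan m (p ++ v) := by
  induction p using scan_induction m with
  | nil => exact ⟨[], by simp, by simp⟩
  | matched s ih =>
    obtain ⟨q, hq, hv⟩ := ih
    refine ⟨m.result :: q, ?_, fun v => ?_⟩
    · simp [tok.bytes_result m hm]; omega
    · rw [List.cons_append, List.cons_append, scan_cons_of_match]
      exact List.cons_prefix_cons.2 ⟨rfl, hv v⟩
  | unmatched a s hs ih =>
    rcases s with _ | ⟨b, s⟩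
    -- The last token may merge with what follows, so it is given up, at a cost of at most `M`
    -- bytes.
    · exact ⟨[], by simpa using hM a, by simp⟩
    · obtain ⟨q, hq, hv⟩ := ih
      refine ⟨a :: q, ?_, fun v => ?_⟩
      · rw [decode_cons, decode_cons _ a q, List.length_append, List.length_append]; omega
      · rw [List.cons_append, scan_cons_of_not _ _ _ (by simpa using hs)]
        exact List.cons_prefix_cons.2 ⟨rfl, hv v⟩

/-- The stable output of one pass is the known input prefix of the next; each pass gives up at most
`M` bytes. -/
theorem exists_prefix_foldl_scan {M : ℕ} (hM : ∀ t, (tok.bytes t).length ≤ M)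
    (ms : List (MergeRule V)) (hms : ∀ m ∈ ms, m ∈ tok.merges) (p : List V) :
    ∃ q, (tok.decode p).length ≤ (tok.decode q).length + ms.length * M ∧
      ∀ v, q <+: ms.foldl (fun ts m => scan m ts) (p ++ v) := by
  induction ms generalizing p with
  | nil => exact ⟨p, by simp, by simp⟩
  | cons m ms ih =>
    rw [List.forall_mem_cons] at hms
    obtain ⟨p', hp', hv⟩ := tok.exists_prefix_scan hM hms.1 p
    obtain ⟨q, hq, hw⟩ := ih hms.2 p'
    refine ⟨q, ?_, fun v => ?_⟩
    · rw [List.length_cons, Nat.succ_mul]; omega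
    · obtain ⟨w, hw'⟩ := hv v
      rw [List.foldl_cons, ← hw']
      exact hw w

/-- BPE has bounded lookahead: all but boundedly many bytes of `P` are encoded independently of
what follows. -/
theorem exists_prefix_encode {M : ℕ} (hM : ∀ t, (tok.bytes t).length ≤ M) (P : List UInt8) :
    ∃ q, P.length ≤ (tok.decode q).length + tok.merges.length * M ∧
      ∀ y, q <+: tok.encode (P ++ y) := by
  obtain ⟨q, hq, hv⟩ :=
    tok.exists_prefix_foldl_scan hM tok.merges (fun _ h => h) (P.map tok.byteToken)
  rw [decode_map_byteToken] at hq
  refine ⟨q, hq, fun y => ?_⟩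
  rw [encode_eq_foldl_scan, List.map_append]
  exact hv _

/-- The parent of an edge of the tree that leaves the path to `w` is a valid sequence that extends
`w` and decodes to a prefix of `P`. -/
theorem parent_of_mem_vctEdges_diff {P : List UInt8} {w : List V}
    (hw : ∀ T ∈ tok.VCT P, w <+: T) {e : List V × List V}
    (he : e ∈ tok.vctEdges P \ pathEdges w) :
    tok.IsValid e.1 ∧ w <+: e.1 ∧ tok.decode e.1 <+: P := by
  obtain ⟨u, u'⟩ := e
  obtain ⟨⟨-, ⟨T, hT, huT⟩, t, ht⟩, hpath⟩ := he
  dsimp only at ht huT ⊢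
  subst ht
  refine ⟨hT.2.2.of_prefix ((List.prefix_append _ _).trans huT), ?_, ?_⟩
  -- `w` and the child are both prefixes of `T`, hence comparable; a child inside `w` would put the
  -- edge on the path.
  · rcases List.prefix_or_prefix_of_prefix (hw T hT) huT with h | h
    · rcases List.prefix_concat_iff.1 h with h | h
      · exact absurd ⟨by simp [h], t, rfl⟩ hpath
      · exact h
    · exact absurd ⟨h, t, rfl⟩ hpath
  · obtain ⟨r, rfl⟩ := huT
    refine (tok.decode_prefix_decode ?_).trans hT.2.1
    rw [List.append_assoc, List.dropLast_append_of_ne_nil (by simp)]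
    exact List.prefix_append _ _

theorem encard_vctEdges_diff_le [Fintype V] {Ptrunk Psuffix : List UInt8}
    (h : ∀ T ∈ tok.VCT (Ptrunk ++ Psuffix), tok.encode Ptrunk <+: T) :
    (tok.vctEdges (Ptrunk ++ Psuffix) \ pathEdges (tok.encode Ptrunk)).encard ≤
      (((Psuffix.length + 1) * Fintype.card V : ℕ) : ℕ∞) := by
  -- An edge is determined by how many bytes of `Psuffix` its parent covers (0 to L) and by its new
  -- token.
  let f : Fin (Psuffix.length + 1) × V → List V × List V := fun i =>
    let u := tok.encode (Ptrunk ++ Psuffix.take i.1)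
    (u, u ++ [i.2])
  have hsub : tok.vctEdges (Ptrunk ++ Psuffix) \ pathEdges (tok.encode Ptrunk) ⊆ Set.range f := by
    intro e he
    obtain ⟨hvalid, hpre, hP⟩ := tok.parent_of_mem_vctEdges_diff h he
    obtain ⟨u, u'⟩ := e
    obtain ⟨⟨-, -, t, ht⟩, -⟩ := he
    dsimp only at ht hvalid hpre hP
    subst ht
    have htrunk := tok.decode_prefix_decode hpre
    rw [decode_encode] at htrunk
    obtain ⟨z, hz⟩ := htrunk
    rw [← hz, List.prefix_append_right_inj] at hP
    refine ⟨(⟨z.length, Nat.lt_succ_of_le hP.length_le⟩, t), ?_⟩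
    have hu : tok.encode (Ptrunk ++ Psuffix.take z.length) = u := by
      rw [← List.prefix_iff_eq_take.1 hP, hz, hvalid]
    simp only [f, hu]
  calc _ ≤ (Set.range f).encard := Set.encard_le_encard hsub
    _ ≤ (Set.univ : Set (Fin (Psuffix.length + 1) × V)).encard := by
      rw [← Set.image_univ]; exact Set.encard_image_le _ _
    _ = _ := by
      rw [Set.encard_univ, ENat.card_eq_coe_fintype_card, Fintype.card_prod, Fintype.card_fin]

end Encode

end BPETokenizer

theorem mainTheorem1 {V : Type*} [Fintype V] [DecidableEq V] (tok : BPETokenizer V) :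
    ∃ L₀ : ℕ, ∀ P : List UInt8, ∃ L ≤ L₀, ∃ Ptrunk Psuffix : List UInt8,
      P = Ptrunk ++ Psuffix ∧ Psuffix.length = L ∧
      (∀ T ∈ tok.VCT P, tok.encode Ptrunk <+: T) ∧
      (tok.vctEdges P \ BPETokenizer.pathEdges (tok.encode Ptrunk)).encard ≤
        (((L + 1) * Fintype.card V : ℕ) : ℕ∞) := by
  have hM : ∀ t, (tok.bytes t).length ≤ Finset.univ.sup fun t => (tok.bytes t).length :=
    fun t => Finset.le_sup (f := fun t => (tok.bytes t).length) (Finset.mem_univ t)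
  refine ⟨tok.merges.length * Finset.univ.sup fun t => (tok.bytes t).length, fun P => ?_⟩
  obtain ⟨q, hq, hpre⟩ := tok.exists_prefix_encode hM P
  have hqP : q <+: tok.encode P := by simpa using hpre []
  -- This lets `decode q` serve as the trunk.
  have hvalid : tok.encode (tok.decode q) = q := (tok.isValid_encode P).of_prefix hqP
  have htrunk := tok.decode_prefix_decode hqP
  rw [BPETokenizer.decode_encode] at htrunk
  obtain ⟨s, hs⟩ := htrunk
  have hT : ∀ T ∈ tok.VCT P, tok.encode (tok.decode q) <+: T := by
    rintro T ⟨⟨y, hy⟩, -, hT⟩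
    rw [hvalid, ← hT, ← hy]
    exact hpre y
  refine ⟨s.length, ?_, tok.decode q, s, hs.symm, rfl, hT, ?_⟩
  · have := congrArg List.length hs
    rw [List.length_append] at this
    omega
  · rw [← hs] at hT ⊢
    exact tok.encard_vctEdges_diff_le hT
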